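/- Let $p$ be an odd prime. Let $\nu_p$ denote the $p$-adic valuation (with $\nu_p(0)=\infty$), $\sigma_p(m)$ the sum of the base $p$ digits of $m$, and $S(n,k)$ the Stirling numbers of the second kind. For $l\in\mathbb Z$ let the higher order Bernoulli polynomials $B_m^{(l)}(x)\in\mathbb Q[x]$ be defined by $$\Big(\frac{t}{e^t-1}\Big)^{l}e^{tx}=\sum_{m\ge 0}B_m^{(l)}(x)\,\frac{t^m}{m!},$$ and let the maximum pole of a rational polynomial be the exponent of the highest power of $p$ that occurs in the denominator of any of its coefficients. For $n\ge k$, $S(n,k)$ is called an almost minimum zero case (AMZC) if equality holds in the estimate $\nu_p(S(n,k))\ge\nu_p\big(\binom nk\big)-M$, where $M$ is the maximum pole of $B_{n-k}^{(-k)}(x)$. For $n\ge k\ge 1$, $S(n,k)$ is called a shifted almost minimum zero case (SAMZC) if equality holds in the estimate $\nu_p(S(n,k))\ge\nu_p\big(\binom{n-1}{k-1}\big)-M'$, where $M'$ is the maximum pole of $B_{n-k}^{(-k+1)}(x)$. For a finitely supported sequence $u=(u_1,u_2,\dots)$ of natural numbers put $w=\sum_i i\,u_i$ and $d=\sum_i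 u_i$. For $l\in\mathbb Z$ and $m\in\mathbb N$, the number $\tau_u$ belonging to $B_m^{(l)}(x)$ is $$\tau_u=m(m-1)\cdots(m-w+1)\,\binom{s}{d}\,\frac{d!}{u_1!\,u_2!\cdots}\cdot\frac{1}{2^{u_1}3^{u_2}4^{u_3}\cdots},\qquad s=l-m-1 .$$ Let $n,k$ be natural numbers with $\nu_p(k)\le\nu_p(n)$ such that $r=(n-k)/(p-1)$ is a natural number, and let $M$ be the maximum pole of $B_{n-k}^{(-k)}(x)$. Then the following are equivalent: 1. $S(n,k)$ is an AMZC; 2. $S(n+1,k+1)$ is a SAMZC; 3. $\nu_p\big(\binom{r+n}{n}\big)=\dfrac{\sigma_p(n-k)}{p-1}-M$; 4. $\nu_p(\tau_u)=-M$, where $\tau_u$ belongs to $B_{n-k}^{(-k)}(x)$ and $u$ is the partition with $u_{p-1}=r$ and all other $u_i=0$. Furthermore, if these conditions hold, then $$\nu_p(S(n+1,k+1))=\nu_p(S(n,k))=\frac{\sigma_p(k)-\sigma_p(n)}{p-1}+\nu_p\Big(\binom{r+n}{n}\Big).$$ -/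

import Mathlib

namespace StirlingPole

/-- The power series `(e^t - 1) / t = ∑ t^n / (n+1)!`; see `X_mul_expQuot`. -/
noncomputable def expQuot : PowerSeries ℚ :=
  PowerSeries.mk fun n => ((n + 1).factorial : ℚ)⁻¹

theorem X_mul_expQuot : PowerSeries.X * expQuot = PowerSeries.exp ℚ - 1 := by
  ext n
  cases n with
  | zero => simp
  | succ n => simp [expQuot, PowerSeries.coeff_succ_X_mul, PowerSeries.coeff_exp,
      PowerSeries.coeff_one]

theorem expQuot_mul_inv : expQuot * expQuot⁻¹ = 1 :=
  PowerSeries.mul_inv_cancel _ (by simp [expQuot])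

/-- The power series `(t / (e^t - 1))^l` for an integer exponent `l`, where `t / (e^t - 1)` is the
inverse of `expQuot` (one of the two factors is always `1`). -/
noncomputable def bernoulliGen (l : ℤ) : PowerSeries ℚ :=
  expQuot⁻¹ ^ l.toNat * expQuot ^ (-l).toNat

/-- The higher order Bernoulli polynomial `B_n^{(l)}(x)`, defined by
`(t / (e^t - 1))^l * e^{tx} = ∑ B_n^{(l)}(x) t^n / n!`, an identity of power series in `t` with
coefficients in `ℚ[x]`. -/
noncomputable def higherBernoulli (l : ℤ) (n : ℕ) : Polynomial ℚ :=
  (n.factorial : ℚ) • PowerSeries.coeff n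
    (PowerSeries.map Polynomial.C (bernoulliGen l) *
      PowerSeries.rescale Polynomial.X (PowerSeries.exp (Polynomial ℚ)))

/-- The maximum pole of a rational polynomial: the exponent of the highest power of `p` in the
denominator of any coefficient. -/
def maxPole (p : ℕ) (f : Polynomial ℚ) : ℕ :=
  f.support.sup fun i => padicValNat p (f.coeff i).den

/-- The sum `σ_p(n)` of the base `p` digits of `n`. -/
def digitSum (p n : ℕ) : ℕ := (Nat.digits p n).sum

/-- `S(n,k)` is an almost minimum zero case: equality holds in the estimate
`ν_p(S(n,k)) ≥ ν_p(C(n,k)) - M`, with `M` the maximum pole of `B_{n-k}^{(-k)}(x)`. -/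
def IsAMZC (p n k : ℕ) : Prop :=
  (padicValNat p (Nat.stirlingSecond n k) : ℤ) =
    padicValNat p (n.choose k) - maxPole p (higherBernoulli (-(k : ℤ)) (n - k))

/-- `S(n,k)` (with `1 ≤ k ≤ n`) is a shifted almost minimum zero case: equality holds in the
estimate `ν_p(S(n,k)) ≥ ν_p(C(n-1,k-1)) - M'`, with `M'` the maximum pole of
`B_{n-k}^{(-k+1)}(x)`. -/
def IsSAMZC (p n k : ℕ) : Prop :=
  (padicValNat p (Nat.stirlingSecond n k) : ℤ) =
    padicValNat p ((n - 1).choose (k - 1)) -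
      maxPole p (higherBernoulli (-(k : ℤ) + 1) (n - k))

/-- The weight `w(u) = ∑ i u_i` of a partition `u`, where `u i` is the multiplicity of the part
`i ≥ 1`. -/
def weight (u : ℕ+ →₀ ℕ) : ℕ := u.sum fun i m => (i : ℕ) * m

/-- The number `d(u) = ∑ u_i` of summands of a partition `u`. -/
def parts (u : ℕ+ →₀ ℕ) : ℕ := u.sum fun _ m => m

/-- `Λ^u = 2^{u_1} 3^{u_2} ⋯`. -/
def lam (u : ℕ+ →₀ ℕ) : ℕ := u.prod fun i m => ((i : ℕ) + 1) ^ m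

/-- `t_u(s) = C(s,d) * (d choose u_1, u_2, …) / Λ^u`, with `d = d(u)`. -/
noncomputable def tU (s : ℤ) (u : ℕ+ →₀ ℕ) : ℚ :=
  ((Ring.choose s (parts u) : ℤ) : ℚ) * (u.multinomial : ℚ) / (lam u : ℚ)

/-- The companion sequence `τ_u = (n)_w t_u(l - n - 1)`, with `w = w(u)`, that belongs to
`B_n^{(l)}(x)`. -/
noncomputable def tau (l : ℤ) (n : ℕ) (u : ℕ+ →₀ ℕ) : ℚ :=
  (n.descFactorial (weight u) : ℚ) * tU (l - n - 1) u

end StirlingPole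

namespace StirlingPole

open PowerSeries Finset

/-! Put `L = log(1+z)/z` and `m = n - k = r(p-1)`. The differential equation of `L` gives `S(n,k) =
C(n,k) m! [z^m] L^{-(n+1)}(1+z)^{-1}` and `S(n+1,k+1) = C(n,k) m! [z^m] L^{-(n+1)}`. So both cases
ask whether `p^M` times such a coefficient is a `p`-adic unit.

Split `L` at degree `p - 1` (`logQuot_eq`): `L = A + z^(p-1)/p * (1 + D)`, with `A` integral and `D`
zero modulo `p` as a Hurwitz series. Expanding in powers of `z^(p-1)/p` writes these coefficients as
sums over `j` of `τ_j` times integral numbers, where `τ_j` is the `τ_u` with `u_{p-1} = j`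
(`exists_coeff_logQuot_inv_pow_mul`, `descFactorial_mul_coeff_eq_sum`).

The coefficients of the Bernoulli polynomial in the falling factorial basis have poles at most `M`.
They are triangular in the `τ_j`, so every `p^M τ_j` is integral (`padicNorm_mul_tauSingle_le_one`).
In top degree only `j = r` survives modulo `p`: for `j ≤ r - 2` a factorial supplies a factor `p`,
and for `j = r - 1` the condition `ν(k) ≤ ν(n)` does. Hence both Stirling quotients are congruent to
`τ_r` after scaling by `p^M`. Legendre's formula turns the valuation of `τ_r` into condition 3. -/

/-- The power series `log (1 + z) / z`. -/
noncomputable def logQuot : PowerSeries ℚ :=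
  PowerSeries.mk fun i => (-1) ^ i / ((i : ℚ) + 1)

/-! ### Powers of `z / log(1+z)` and Stirling numbers. -/

theorem constantCoeff_logQuot : constantCoeff logQuot = 1 := by
  simp [logQuot, ← coeff_zero_eq_constantCoeff_apply]

theorem logQuot_mul_inv : logQuot * logQuot⁻¹ = 1 :=
  PowerSeries.mul_inv_cancel _ (by simp [constantCoeff_logQuot])

theorem one_add_X_mul_inv : (1 + X : PowerSeries ℚ) * (1 + X)⁻¹ = 1 :=
  PowerSeries.mul_inv_cancel _ (by simp)

/-- The derivative of `z L = log(1+z)` is `1/(1+z)`. -/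
theorem logQuot_ode : (1 + X) * (logQuot + X * derivative ℚ logQuot) = 1 := by
  have h : logQuot + X * derivative ℚ logQuot = PowerSeries.mk fun i => (-1 : ℚ) ^ i := by
    ext n
    cases n with
    | zero => simp [logQuot]
    | succ n =>
      simp only [logQuot, map_add, coeff_mk, coeff_succ_X_mul, coeff_derivative]
      push_cast
      field_simp
      ring
  rw [h]
  ext n
  cases n with
  | zero => simp
  | succ n => simp [add_mul, coeff_succ_X_mul, coeff_one, pow_succ]

theorem logQuot_inv_ode :
    (1 + X) * (X * derivative ℚ logQuot⁻¹ - logQuot⁻¹) = -logQuot⁻¹ ^ 2 := by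
  rw [derivative_inv']
  linear_combination (-logQuot⁻¹ ^ 2) * logQuot_ode + (1 + X) * logQuot⁻¹ * logQuot_mul_inv

theorem logQuot_inv_pow_ode (n : ℕ) :
    (1 + X) * (X * derivative ℚ (logQuot⁻¹ ^ n) - (n : PowerSeries ℚ) * logQuot⁻¹ ^ n) =
      -((n : PowerSeries ℚ) * logQuot⁻¹ ^ (n + 1)) := by
  cases n with
  | zero => simp
  | succ n =>
    rw [Derivation.leibniz_pow]
    simp only [Nat.add_sub_cancel, nsmul_eq_mul, smul_eq_mul]
    linear_combination ((n + 1 : ℕ) : PowerSeries ℚ) * logQuot⁻¹ ^ n * logQuot_inv_ode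

theorem coeff_X_mul_derivative (n : ℕ) (f : PowerSeries ℚ) :
    coeff n (X * derivative ℚ f) = n * coeff n f := by
  cases n with
  | zero => simp
  | succ n => rw [coeff_succ_X_mul, coeff_derivative]; push_cast; ring

theorem coeff_natCast_mul (n m : ℕ) (f : PowerSeries ℚ) :
    coeff n ((m : PowerSeries ℚ) * f) = m * coeff n f := by
  rw [← nsmul_eq_mul, map_nsmul, nsmul_eq_mul]

theorem coeff_logQuot_inv_pow_succ (N n : ℕ) :
    (n : ℚ) * coeff (N + 1) (logQuot⁻¹ ^ (n + 1)) =
      ((n : ℚ) - (N + 1)) * coeff (N + 1) (logQuot⁻¹ ^ n) +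
        ((n : ℚ) - N) * coeff N (logQuot⁻¹ ^ n) := by
  have h := congrArg (coeff (N + 1)) (logQuot_inv_pow_ode n)
  rw [add_mul, one_mul, map_add, coeff_succ_X_mul, map_sub, map_sub, coeff_X_mul_derivative,
    coeff_X_mul_derivative, map_neg, coeff_natCast_mul, coeff_natCast_mul, coeff_natCast_mul] at h
  push_cast at h
  linear_combination h

theorem coeff_logQuot_inv_pow_mul_inv (N n : ℕ) :
    (n : ℚ) * coeff N (logQuot⁻¹ ^ (n + 1) * (1 + X)⁻¹) =
      ((n : ℚ) - N) * coeff N (logQuot⁻¹ ^ n) := by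
  have h : (n : PowerSeries ℚ) * (logQuot⁻¹ ^ (n + 1) * (1 + X)⁻¹) =
      (n : PowerSeries ℚ) * logQuot⁻¹ ^ n - X * derivative ℚ (logQuot⁻¹ ^ n) := by
    linear_combination (1 + X)⁻¹ * logQuot_inv_pow_ode n -
      (X * derivative ℚ (logQuot⁻¹ ^ n) - (n : PowerSeries ℚ) * logQuot⁻¹ ^ n) *
        one_add_X_mul_inv
  rw [← coeff_natCast_mul, h, map_sub, coeff_natCast_mul, coeff_X_mul_derivative]
  ring

/-- Along `n = N + q + 1` the recurrence from the differential equation becomes the recurrence of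
the Stirling numbers. Its two terms lower `q` and `N` respectively, hence the double induction. -/
theorem coeff_logQuot_inv_pow (N q : ℕ) :
    coeff N (logQuot⁻¹ ^ (N + q + 1)) =
      (q.factorial : ℚ) * (N + q + 1).stirlingSecond (q + 1) / (N + q).factorial := by
  induction N generalizing q with
  | zero =>
    simp [constantCoeff_logQuot, Nat.stirlingSecond_self, Nat.factorial_ne_zero]
  | succ N ihN =>
    induction q with
    -- Here the factor `n - (N + 1)` in the recurrence vanishes, so only the term of lower `N`
    -- remains.
    | zero =>
      have h := coeff_logQuot_inv_pow_succ N (N + 1)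
      have h2 := ihN 0
      simp only [Nat.add_zero, Nat.zero_add, Nat.stirlingSecond_one_right] at h h2 ⊢
      have : ((N : ℚ) + 1) ≠ 0 := by positivity
      rw [h2] at h
      rw [Nat.factorial_succ]
      push_cast at h ⊢
      have hf : (N.factorial : ℚ) ≠ 0 := by positivity
      field_simp at h ⊢
      linear_combination h
    | succ q ihq =>
      have h := coeff_logQuot_inv_pow_succ N (N + 1 + q + 1)
      have h2 := ihN (q + 1)
      rw [show N + (q + 1) + 1 = N + 1 + q + 1 by ring] at h2
      rw [h2, ihq] at h
      rw [show N + 1 + (q + 1) + 1 = N + 1 + q + 1 + 1 by ring,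
        show N + 1 + (q + 1) = N + 1 + q + 1 by ring, Nat.stirlingSecond_succ_succ]
      rw [show N + (q + 1) = N + 1 + q by ring] at h
      have : ((N : ℚ) + 1 + q + 1) ≠ 0 := by positivity
      have hf : ((N + 1 + q).factorial : ℚ) ≠ 0 := by positivity
      rw [Nat.factorial_succ (N + 1 + q), Nat.factorial_succ q] at *
      push_cast at h ⊢
      field_simp at h ⊢
      linear_combination h

theorem coeff_logQuot_inv_pow_mul (N q : ℕ) :
    coeff N (logQuot⁻¹ ^ (N + q + 1) * (1 + X)⁻¹) =
      (q.factorial : ℚ) * (N + q).stirlingSecond q / (N + q).factorial := by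
  have h := coeff_logQuot_inv_pow_mul_inv N (N + q)
  cases q with
  | zero =>
    cases N with
    | zero => simp [constantCoeff_logQuot]
    | succ N =>
      push_cast at h
      have : ((N : ℚ) + 1) ≠ 0 := by positivity
      simp only [Nat.add_zero, Nat.stirlingSecond_succ_zero] at h ⊢
      simpa [this] using h
  | succ q =>
    rw [show N + (q + 1) = N + q + 1 by ring] at *
    rw [coeff_logQuot_inv_pow] at h
    have : ((N : ℚ) + q + 1) ≠ 0 := by positivity
    have hf : ((N + q).factorial : ℚ) ≠ 0 := by positivity
    rw [Nat.factorial_succ (N + q), Nat.factorial_succ q]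
    push_cast at h ⊢
    field_simp at h ⊢
    linear_combination h

theorem coeff_exp_sub_one_pow (n q : ℕ) :
    coeff n ((exp ℚ - 1) ^ q) = (q.factorial : ℚ) * n.stirlingSecond q / n.factorial := by
  induction n generalizing q with
  | zero => cases q <;> simp
  | succ n ih =>
    cases q with
    | zero => simp [coeff_one]
    | succ q =>
      have h : derivative ℚ ((exp ℚ - 1) ^ (q + 1)) =
          ((q + 1 : ℕ) : PowerSeries ℚ) * ((exp ℚ - 1) ^ (q + 1) + (exp ℚ - 1) ^ q) := by
        rw [Derivation.leibniz_pow, map_sub, derivative_exp]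
        simp only [Nat.add_sub_cancel, nsmul_eq_mul, smul_eq_mul, Derivation.map_one_eq_zero]
        ring
      have h2 := congrArg (coeff n) h
      rw [coeff_derivative, coeff_natCast_mul, map_add, ih, ih] at h2
      rw [Nat.stirlingSecond_succ_succ, Nat.factorial_succ n, Nat.factorial_succ q] at *
      have : ((n : ℚ) + 1) ≠ 0 := by positivity
      have hf : (n.factorial : ℚ) ≠ 0 := by positivity
      push_cast at h2 ⊢
      field_simp at h2 ⊢
      linear_combination h2

theorem exp_sub_one_pow_eq (k : ℕ) : (exp ℚ - 1) ^ k = X ^ k * expQuot ^ k := by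
  rw [← X_mul_expQuot, mul_pow]

/-! ### Coefficients of the higher order Bernoulli polynomials. -/

theorem coeff_higherBernoulli (l : ℤ) (m i : ℕ) (hi : i ≤ m) :
    (higherBernoulli l m).coeff i =
      (m.factorial : ℚ) / i.factorial * coeff (m - i) (bernoulliGen l) := by
  unfold higherBernoulli
  rw [Polynomial.coeff_smul, coeff_mul, Polynomial.finsetSum_coeff,
    Finset.sum_eq_single (m - i, i)]
  · simp only [coeff_map, coeff_rescale, coeff_exp, smul_eq_mul]
    rw [Polynomial.algebraMap_eq, mul_comm (Polynomial.X ^ i), ← mul_assoc,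
      ← Polynomial.C_mul, Polynomial.coeff_C_mul, Polynomial.coeff_X_pow_self]
    simp
    ring
  · rintro ⟨a, b⟩ hab hne
    simp only [coeff_map, coeff_rescale, coeff_exp]
    rw [Polynomial.algebraMap_eq, mul_comm (Polynomial.X ^ b), ← mul_assoc,
      ← Polynomial.C_mul, Polynomial.coeff_C_mul, Polynomial.coeff_X_pow, if_neg, mul_zero]
    rintro rfl
    have := HasAntidiagonal.mem_antidiagonal.1 hab
    simp only at this
    exact hne (by ext <;> simp; omega)
  · intro h
    exact absurd (HasAntidiagonal.mem_antidiagonal.2 (by omega)) h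

theorem bernoulliGen_neg (k : ℕ) : bernoulliGen (-(k : ℤ)) = expQuot ^ k := by
  simp [bernoulliGen]

/-- The passage from the coefficients of `B_m^{(-k)}(x)` in the basis of powers to those in the
basis of falling factorials. -/
theorem sum_stirlingSecond_mul_coeff (k m i : ℕ) (hi : i ≤ m) :
    ∑ q ∈ range (m + 1), (q.stirlingSecond i : ℚ) * (higherBernoulli (-(k : ℤ)) m).coeff q =
      (m.factorial : ℚ) / i.factorial *
        coeff (m - i) (logQuot⁻¹ ^ (m + k + 1) * (1 + X)⁻¹) := by
  -- Both sides equal `(i+k)! S(m+k,i+k) / (m+k)!`, a case of Lagrange inversion between `log` and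
  -- `exp`.
  have h1 : coeff (m - i) (logQuot⁻¹ ^ (m + k + 1) * (1 + X)⁻¹) =
      coeff (m + k) ((exp ℚ - 1) ^ (i + k)) := by
    have := coeff_logQuot_inv_pow_mul (m - i) (i + k)
    rw [show m - i + (i + k) = m + k by omega] at this
    rw [this, coeff_exp_sub_one_pow]
  have h2 : coeff (m + k) ((exp ℚ - 1) ^ (i + k)) = coeff m ((exp ℚ - 1) ^ i * expQuot ^ k) := by
    rw [pow_add, exp_sub_one_pow_eq k, ← mul_assoc, mul_comm _ (X ^ k), mul_assoc,
      add_comm m k, coeff_X_pow_mul']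
    simp
  rw [h1, h2, coeff_mul, Finset.Nat.sum_antidiagonal_eq_sum_range_succ_mk, mul_sum]
  refine sum_congr rfl fun q hq => ?_
  rw [coeff_higherBernoulli _ _ _ (by simpa [Nat.lt_succ_iff] using hq), bernoulliGen_neg,
    coeff_exp_sub_one_pow]
  have : (i.factorial : ℚ) ≠ 0 := by positivity
  have : (q.factorial : ℚ) ≠ 0 := by positivity
  field_simp

/-! ### Integral series and Hurwitz series. -/

/-- All coefficients are `p`-integral. -/
def IntegralSeries (p : ℕ) (F : PowerSeries ℚ) : Prop := ∀ q, padicNorm p (coeff q F) ≤ 1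

/-- `F = ∑ a_q t^q / q!` with `p`-integral numbers `a_q`. -/
def HurwitzIntegral (p : ℕ) (F : PowerSeries ℚ) : Prop :=
  ∀ q : ℕ, padicNorm p (q.factorial * coeff q F) ≤ 1

/-- `F = ∑ a_q t^q / q!` with numbers `a_q` of positive `p`-adic valuation. -/
def HurwitzSmall (p : ℕ) (F : PowerSeries ℚ) : Prop :=
  ∀ q : ℕ, padicNorm p (q.factorial * coeff q F) < 1

/-- The sum of a series with `p`-integral coefficients and one that vanishes modulo `p` in the ring
of Hurwitz series. -/
def AlmostIntegral (p : ℕ) (F : PowerSeries ℚ) : Prop :=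
  ∃ A B, IntegralSeries p A ∧ HurwitzSmall p B ∧ F = A + B

/-- The terms of degree less than `p - 1` of `log (1 + z) / z`. -/
noncomputable def logLow (p : ℕ) : PowerSeries ℚ :=
  PowerSeries.mk fun i => if i < p - 1 then (-1) ^ i / ((i : ℚ) + 1) else 0

/-- The series `D` with `log (1 + z) / z = logLow + z^(p-1) / p * (1 + D)`. -/
noncomputable def logHigh (p : ℕ) : PowerSeries ℚ :=
  PowerSeries.mk fun i => if i = 0 then 0 else (-1) ^ i * (p : ℚ) / ((i : ℚ) + p)

theorem factorial_mul_coeff_mul (F G : PowerSeries ℚ) (q : ℕ) :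
    (q.factorial : ℚ) * coeff q (F * G) = ∑ x ∈ antidiagonal q,
      ((q.choose x.1 : ℕ) : ℚ) * ((x.1.factorial * coeff x.1 F) * (x.2.factorial * coeff x.2 G)) := by
  rw [coeff_mul, mul_sum]
  refine sum_congr rfl fun x hx => ?_
  have hx := HasAntidiagonal.mem_antidiagonal.1 hx
  have : ((q.choose x.1 * x.1.factorial * x.2.factorial : ℕ) : ℚ) = q.factorial := by
    rw [← Nat.choose_mul_factorial_mul_factorial (show x.1 ≤ q by omega),
      show q - x.1 = x.2 by omega]
  rw [← this]
  push_cast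
  ring

/-- The truncated binomial series for the exponent `-(N + 1)`. -/
theorem exists_one_sub_pow_mul_sum {R : Type*} [CommRing R] (Y : R) (N J : ℕ) :
    ∃ g, (1 - Y) ^ (N + 1) * ∑ j ∈ range J, ((N + j).choose j : R) * Y ^ j = 1 + Y ^ J * g := by
  induction N with
  | zero =>
    refine ⟨-1, ?_⟩
    simp only [zero_add, Nat.choose_self, Nat.cast_one, one_mul, pow_one]
    rw [mul_neg_geom_sum]
    ring
  | succ N ih =>
    obtain ⟨g, hg⟩ := ih
    -- Multiplying by `1 - Y` lowers `N` by Pascal's rule, up to one boundary term. The value of `c`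
    -- is recorded for the induction on `J`; at `J = 0` it must be `0`, whereas the truncated `J -
    -- 1` would give `1`.
    have tel : ∀ J : ℕ, ∃ c : R, (1 - Y) * ∑ j ∈ range J, ((N + 1 + j).choose j : R) * Y ^ j =
        ∑ j ∈ range J, ((N + j).choose j : R) * Y ^ j - c * Y ^ J ∧
          c = if J = 0 then 0 else ((N + J).choose (J - 1) : R) := by
      intro J
      induction J with
      | zero => exact ⟨0, by simp⟩
      | succ J ihJ =>
        obtain ⟨c, hc, hc'⟩ := ihJ
        refine ⟨((N + 1 + J).choose J : R), ?_, by simp [add_right_comm, add_assoc]⟩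
        rw [sum_range_succ, sum_range_succ, mul_add, hc]
        have : ((N + 1 + J).choose J : R) = ((N + J).choose J : R) + c := by
          rw [hc']
          cases J with
          | zero => simp
          | succ J =>
            rw [show N + 1 + (J + 1) = N + (J + 1) + 1 by ring, Nat.choose_succ_succ]
            simp [add_comm]
        rw [pow_succ Y J]
        linear_combination Y ^ J * this
    obtain ⟨c, hc, -⟩ := tel J
    refine ⟨g - (1 - Y) ^ (N + 1) * c, ?_⟩
    rw [pow_succ, mul_assoc, hc, mul_sub, hg]
    ring

section padic

variable {p : ℕ}

theorem IntegralSeries.one : IntegralSeries p 1 := by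
  intro q
  rw [coeff_one]
  split_ifs <;> simp

theorem HurwitzSmall.hurwitzIntegral {F : PowerSeries ℚ} (hF : HurwitzSmall p F) :
    HurwitzIntegral p F :=
  fun q => (hF q).le

theorem IntegralSeries.almostIntegral {F : PowerSeries ℚ} (hF : IntegralSeries p F) :
    AlmostIntegral p F :=
  ⟨F, 0, hF, fun q => by simp, by simp⟩

variable [Fact p.Prime]

theorem padicNorm_mul_le_one {a b : ℚ} (ha : padicNorm p a ≤ 1) (hb : padicNorm p b ≤ 1) :
    padicNorm p (a * b) ≤ 1 := by
  rw [padicNorm.mul]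
  exact mul_le_one₀ ha (padicNorm.nonneg _) hb

theorem padicNorm_mul_lt_one {a b : ℚ} (ha : padicNorm p a ≤ 1) (hb : padicNorm p b < 1) :
    padicNorm p (a * b) < 1 := by
  rw [padicNorm.mul]
  exact mul_lt_one_of_nonneg_of_lt_one_right ha (padicNorm.nonneg _) hb

theorem padicNorm_add_le_one {a b : ℚ} (ha : padicNorm p a ≤ 1) (hb : padicNorm p b ≤ 1) :
    padicNorm p (a + b) ≤ 1 :=
  padicNorm.nonarchimedean.trans (max_le ha hb)

theorem padicNorm_add_lt_one {a b : ℚ} (ha : padicNorm p a < 1) (hb : padicNorm p b < 1) :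
    padicNorm p (a + b) < 1 :=
  padicNorm.nonarchimedean.trans_lt (max_lt ha hb)

theorem padicNorm_eq_one_iff_of_sub_lt_one {a b : ℚ} (h : padicNorm p (a - b) < 1) :
    padicNorm p a = 1 ↔ padicNorm p b = 1 := by
  have key : ∀ x y : ℚ, padicNorm p (x - y) < 1 → padicNorm p y = 1 → padicNorm p x = 1 := by
    intro x y hxy hy
    have := padicNorm.add_eq_max_of_ne (p := p) (q := x - y) (r := y) (by rw [hy]; exact hxy.ne)
    rw [sub_add_cancel, hy, max_eq_right hxy.le] at this
    exact this
  refine ⟨fun ha => key b a ?_ ha, key a b h⟩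
  rwa [← neg_sub, padicNorm.neg]

theorem IntegralSeries.mul {F G : PowerSeries ℚ} (hF : IntegralSeries p F)
    (hG : IntegralSeries p G) : IntegralSeries p (F * G) := by
  intro q
  rw [coeff_mul]
  exact padicNorm.sum_le' (fun x _ => padicNorm_mul_le_one (hF _) (hG _)) zero_le_one

theorem IntegralSeries.inv {F : PowerSeries ℚ} (hF : IntegralSeries p F)
    (h1 : constantCoeff F = 1) : IntegralSeries p F⁻¹ := by
  intro q
  induction q using Nat.strong_induction_on with
  | _ q ih =>
    rw [coeff_inv, h1]
    split_ifs with h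
    · simp
    · refine padicNorm_mul_le_one (by simp) (padicNorm.sum_le' (fun x _ => ?_) zero_le_one)
      split_ifs with hx
      · exact padicNorm_mul_le_one (hF _) (ih _ hx)
      · simp

theorem integralSeries_one_add_X_inv : IntegralSeries p (1 + X)⁻¹ :=
  IntegralSeries.inv (fun q => by
    rw [map_add, coeff_one, coeff_X]
    refine padicNorm_add_le_one ?_ ?_ <;> split_ifs <;> simp) (by simp)

theorem IntegralSeries.hurwitzIntegral {F : PowerSeries ℚ} (hF : IntegralSeries p F) :
    HurwitzIntegral p F :=
  fun q => padicNorm_mul_le_one (padicNorm.of_nat _) (hF q)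

theorem HurwitzSmall.mul {F G : PowerSeries ℚ} (hF : HurwitzIntegral p F)
    (hG : HurwitzSmall p G) : HurwitzSmall p (F * G) := by
  intro q
  rw [factorial_mul_coeff_mul]
  exact padicNorm.sum_lt' (fun x _ => padicNorm_mul_lt_one (padicNorm.of_nat _)
    (padicNorm_mul_lt_one (hF _) (hG _))) one_pos

theorem HurwitzSmall.add {F G : PowerSeries ℚ} (hF : HurwitzSmall p F)
    (hG : HurwitzSmall p G) : HurwitzSmall p (F + G) := by
  intro q
  rw [map_add, mul_add]
  exact padicNorm_add_lt_one (hF q) (hG q)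

/-- Integral series are Hurwitz integral, and the small series absorb multiplication by those. -/
theorem AlmostIntegral.mul {F G : PowerSeries ℚ} (hF : AlmostIntegral p F)
    (hG : AlmostIntegral p G) : AlmostIntegral p (F * G) := by
  obtain ⟨A, B, hA, hB, rfl⟩ := hF
  obtain ⟨A', B', hA', hB', rfl⟩ := hG
  exact ⟨A * A', A * B' + A' * B + B * B', hA.mul hA',
    ((HurwitzSmall.mul hA.hurwitzIntegral hB').add (HurwitzSmall.mul hA'.hurwitzIntegral hB)).add
      (HurwitzSmall.mul hB.hurwitzIntegral hB'), by ring⟩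

theorem AlmostIntegral.pow {F : PowerSeries ℚ} (hF : AlmostIntegral p F) (n : ℕ) :
    AlmostIntegral p (F ^ n) := by
  induction n with
  | zero => simpa using IntegralSeries.one.almostIntegral
  | succ n ih => rw [pow_succ]; exact ih.mul hF

theorem AlmostIntegral.hurwitzIntegral {F : PowerSeries ℚ} (hF : AlmostIntegral p F) :
    HurwitzIntegral p F := by
  obtain ⟨A, B, hA, hB, rfl⟩ := hF
  intro q
  rw [map_add, mul_add]
  exact padicNorm_add_le_one (hA.hurwitzIntegral q) (hB q).le

/-- The integral part gains the factor `p` of `q!`; the small part has one already. Mere Hurwitz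
integrality would not suffice. -/
theorem AlmostIntegral.factorial_mul_coeff_lt_one {F : PowerSeries ℚ} (hF : AlmostIntegral p F)
    {q : ℕ} (hq : p ≤ q) : padicNorm p (q.factorial * coeff q F) < 1 := by
  obtain ⟨A, B, hA, hB, rfl⟩ := hF
  rw [map_add, mul_add]
  refine padicNorm_add_lt_one ?_ (hB q)
  rw [mul_comm]
  refine padicNorm_mul_lt_one (hA q) ?_
  rw [padicNorm.nat_lt_one_iff]
  exact Nat.dvd_factorial (Fact.out : p.Prime).pos hq

/-! ### Splitting the logarithm at degree `p - 1`. -/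

/-- For exponent at least 2 the number `i` is so large that `i!` contains two factors `p^(exponent -
1)`. This fails for `p = 2`, `i = 2`. -/
theorem pow_dvd_factorial_of_pow_dvd_add (hodd : p ≠ 2) {i e : ℕ} (hi : 1 ≤ i)
    (h : p ^ e ∣ i + p) : p ^ e ∣ i.factorial := by
  have hp : p.Prime := Fact.out
  have h3 : 3 ≤ p := by have := hp.two_le; omega
  match e with
  | 0 => simp
  | 1 =>
    rw [pow_one] at *
    have : p ∣ i := by simpa using h
    exact Nat.dvd_factorial hp.pos (Nat.le_of_dvd hi this)
  | e + 2 =>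
    set x := p ^ (e + 1) with hx
    have hpx : p ≤ x := by rw [hx]; exact Nat.le_self_pow (by omega) p
    have hle : p ^ (e + 2) ≤ i + p := Nat.le_of_dvd (by omega) h
    -- Since `p ≥ 3` and `p ≤ x`, one has `i ≥ p x - p ≥ 3x - x`.
    have h2x : 2 * x ≤ i := by
      have : p ^ (e + 2) = x * p := pow_succ _ _
      nlinarith
    have hxx : p ^ (e + 2) ∣ x * x := by
      rw [hx, ← pow_add]
      exact pow_dvd_pow _ (by omega)
    refine (hxx.trans ?_).trans (Nat.factorial_dvd_factorial h2x)
    have hxf : x ∣ x.factorial := Nat.dvd_factorial (by omega) le_rfl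
    rw [two_mul]
    exact (mul_dvd_mul hxf hxf).trans (Nat.factorial_mul_factorial_dvd_factorial_add x x)

theorem logQuot_eq (hodd : p ≠ 2) :
    logQuot = logLow p + C (p : ℚ)⁻¹ * X ^ (p - 1) * (1 + logHigh p) := by
  have hp : p.Prime := Fact.out
  have hp0 : (p : ℚ) ≠ 0 := by exact_mod_cast hp.ne_zero
  have hev : Even (p - 1) := hp.even_sub_one hodd
  ext w
  rw [map_add, mul_assoc, coeff_C_mul, coeff_X_pow_mul']
  simp only [logQuot, logLow, logHigh, coeff_mk, map_add, coeff_one]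
  by_cases h : w < p - 1
  · rw [if_pos h, if_neg (by omega)]
    simp
  · obtain ⟨i, rfl⟩ := Nat.exists_eq_add_of_le (not_lt.1 h)
    rw [if_neg h, if_pos (by omega), Nat.add_sub_cancel_left, pow_add, hev.neg_one_pow]
    have hc : ((p - 1 + i : ℕ) : ℚ) + 1 = i + p := by
      rw [show (p - 1 + i : ℕ) = p + i - 1 by have := hp.one_le; omega,
        Nat.cast_sub (by have := hp.one_le; omega)]
      push_cast; ring
    rw [hc]
    have hip : (i : ℚ) + p ≠ 0 := by positivity
    split_ifs with hi
    · subst hi; simp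
    · field_simp; ring

theorem logLow_integral : IntegralSeries p (logLow p) := by
  intro q
  have hp : p.Prime := Fact.out
  simp only [logLow, coeff_mk]
  split_ifs with h
  · have h1 : padicNorm p ((q : ℚ) + 1) = 1 := by
      have : ((q : ℚ) + 1) = ((q + 1 : ℕ) : ℚ) := by push_cast; ring
      rw [this, padicNorm.nat_eq_one_iff]
      exact fun hd => by have := Nat.le_of_dvd (by omega) hd; omega
    rw [padicNorm.div, h1, div_one]
    exact_mod_cast padicNorm.of_int (p := p) ((-1) ^ q)
  · simp

theorem constantCoeff_logLow : constantCoeff (logLow p) = 1 := by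
  have hp : p.Prime := Fact.out
  have : 0 < p - 1 := by have := hp.two_le; omega
  simp [logLow, ← coeff_zero_eq_constantCoeff_apply, this]

/-- The power of `p` in the denominator `q + p` divides `q!`, so the numerator `p` is left over. -/
theorem logHigh_small (hodd : p ≠ 2) : HurwitzSmall p (logHigh p) := by
  intro q
  have hp : p.Prime := Fact.out
  simp only [logHigh, coeff_mk]
  split_ifs with hq
  · simp
  · have hd : p ^ padicValNat p (q + p) ∣ q.factorial :=
      pow_dvd_factorial_of_pow_dvd_add hodd (by omega) pow_padicValNat_dvd
    have h0 : q + p ≠ 0 := by omega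
    obtain ⟨c, hc⟩ := hd
    have hn : padicNorm p ((q : ℚ) + p) = padicNorm p ((p : ℚ) ^ padicValNat p (q + p)) := by
      have h1 : ((q + p : ℕ) : ℚ) ≠ 0 := by exact_mod_cast h0
      have hp0 : (p : ℚ) ≠ 0 := by exact_mod_cast hp.ne_zero
      rw [← Nat.cast_add, padicNorm.eq_zpow_of_nonzero h1,
        padicNorm.eq_zpow_of_nonzero (pow_ne_zero _ hp0), padicValRat.of_nat,
        padicValRat.pow, padicValRat.self hp.one_lt, mul_one]
    have hne : padicNorm p ((p : ℚ) ^ padicValNat p (q + p)) ≠ 0 :=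
      padicNorm.nonzero (pow_ne_zero _ (by exact_mod_cast hp.ne_zero))
    have e1 : (q.factorial : ℚ) * ((-1) ^ q * (p : ℚ) / ((q : ℚ) + p)) =
        (p : ℚ) ^ padicValNat p (q + p) * (((-1) ^ q * c : ℤ) * (p : ℚ)) / ((q : ℚ) + p) := by
      rw [hc]; push_cast; ring
    rw [e1, padicNorm.div, hn, padicNorm.mul, mul_div_cancel_left₀ _ hne]
    exact padicNorm_mul_lt_one (padicNorm.of_int _) padicNorm.padicNorm_p_lt_one_of_prime

/-- The binomial expansion of `L^{-(n+1)}` around `A`, with `E_j = (1 + D)^j A^{-(j+n+1)} H`. The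
factor `H` serves both Stirling numbers at once. -/
theorem exists_coeff_logQuot_inv_pow_mul (hodd : p ≠ 2) (n : ℕ) {H : PowerSeries ℚ}
    (hH : IntegralSeries p H) (hH1 : constantCoeff H = 1) :
    ∃ E : ℕ → PowerSeries ℚ, (∀ j, AlmostIntegral p (E j)) ∧ (∀ j, constantCoeff (E j) = 1) ∧
      ∀ w, coeff w (logQuot⁻¹ ^ (n + 1) * H) = ∑ j ∈ range (w + 1),
        (-1) ^ j * ((n + j).choose j : ℚ) / (p : ℚ) ^ j *
          if j * (p - 1) ≤ w then coeff (w - j * (p - 1)) (E j) else 0 := by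
  have hp : p.Prime := Fact.out
  set A := logLow p with hA
  set D := logHigh p with hD
  have hAi : A * A⁻¹ = 1 := PowerSeries.mul_inv_cancel _ (by simp [hA, constantCoeff_logLow])
  have hAint : IntegralSeries p A⁻¹ := logLow_integral.inv constantCoeff_logLow
  have hD0 : constantCoeff D = 0 := by
    simp [hD, logHigh, ← coeff_zero_eq_constantCoeff_apply]
  have hDalm : AlmostIntegral p (1 + D) :=
    ⟨1, D, IntegralSeries.one, logHigh_small hodd, rfl⟩
  refine ⟨fun j => (1 + D) ^ j * A⁻¹ ^ (j + (n + 1)) * H, fun j =>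
    ((hDalm.pow j).mul (hAint.almostIntegral.pow _)).mul hH.almostIntegral, fun j => ?_,
    fun w => ?_⟩
  · simp [hD0, hH1, hA, constantCoeff_logLow]
  · set Y : PowerSeries ℚ := -(C (p : ℚ)⁻¹ * X ^ (p - 1) * (1 + D) * A⁻¹) with hY
    -- `Y` is divisible by `z^(p-1)`, so truncating at `w + 1` leaves a remainder of order above
    -- `w`.
    obtain ⟨g, hg⟩ := exists_one_sub_pow_mul_sum Y n (w + 1)
    have hL : logQuot = A * (1 - Y) := by
      rw [logQuot_eq hodd, hY]
      linear_combination (-(C (p : ℚ)⁻¹ * X ^ (p - 1) * (1 + D))) * hAi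
    have hLi : logQuot⁻¹ ^ (n + 1) * (A ^ (n + 1) * (1 - Y) ^ (n + 1)) = 1 := by
      rw [← mul_pow, ← hL, ← mul_pow, mul_comm, logQuot_mul_inv, one_pow]
    have hAp : A ^ (n + 1) * A⁻¹ ^ (n + 1) = 1 := by rw [← mul_pow, hAi, one_pow]
    have key : logQuot⁻¹ ^ (n + 1) * H =
        A⁻¹ ^ (n + 1) * (∑ j ∈ range (w + 1), ((n + j).choose j : PowerSeries ℚ) * Y ^ j) * H -
          Y ^ (w + 1) * (g * logQuot⁻¹ ^ (n + 1) * H) := by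
      linear_combination (-logQuot⁻¹ ^ (n + 1) * H) * hg +
        (A⁻¹ ^ (n + 1) * (∑ j ∈ range (w + 1), ((n + j).choose j : PowerSeries ℚ) * Y ^ j) * H) *
          hLi - (logQuot⁻¹ ^ (n + 1) * (1 - Y) ^ (n + 1) *
            (∑ j ∈ range (w + 1), ((n + j).choose j : PowerSeries ℚ) * Y ^ j) * H) * hAp
    have hX : Y ^ (w + 1) * (g * logQuot⁻¹ ^ (n + 1) * H) = X ^ ((p - 1) * (w + 1)) *
        ((-(C (p : ℚ)⁻¹ * (1 + D) * A⁻¹)) ^ (w + 1) * (g * logQuot⁻¹ ^ (n + 1) * H)) := by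
      have : Y = X ^ (p - 1) * -(C (p : ℚ)⁻¹ * (1 + D) * A⁻¹) := by rw [hY]; ring
      rw [pow_mul, this, mul_pow]
      ring
    have hw : ¬ (p - 1) * (w + 1) ≤ w := by
      have := hp.two_le
      have : w + 1 ≤ (p - 1) * (w + 1) := Nat.le_mul_of_pos_left _ (by omega)
      omega
    rw [key, hX, map_sub, coeff_X_pow_mul', if_neg hw, sub_zero, mul_sum, sum_mul, map_sum]
    refine sum_congr rfl fun j _ => ?_
    have : A⁻¹ ^ (n + 1) * (((n + j).choose j : PowerSeries ℚ) * Y ^ j) * H =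
        C ((-1) ^ j * ((n + j).choose j : ℚ) / (p : ℚ) ^ j) *
          (X ^ (j * (p - 1)) * ((1 + D) ^ j * A⁻¹ ^ (j + (n + 1)) * H)) := by
      have h1 : C ((-1) ^ j * ((n + j).choose j : ℚ) / (p : ℚ) ^ j) =
          (-1) ^ j * ((n + j).choose j : PowerSeries ℚ) * (C (p : ℚ)⁻¹) ^ j := by
        rw [div_eq_mul_inv, ← inv_pow, map_mul, map_mul, map_pow, map_pow, map_neg, map_one, map_natCast]
      rw [h1, hY, neg_pow, mul_comm j, pow_mul, pow_add]
      simp only [mul_pow]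
      ring
    rw [this, coeff_C_mul, coeff_X_pow_mul']

end padic

/-! ### The numbers `τ_u` concentrated in `u_{p-1}`. -/

/-- The number `τ_u` that belongs to `B_m^{(m-n)}(x)`, for the partition `u` with `u_{p-1} = j` and
all other `u_i = 0`. -/
noncomputable def tauSingle (p n m j : ℕ) : ℚ :=
  (m.descFactorial (j * (p - 1)) : ℚ) * ((-1) ^ j * ((n + j).choose j : ℚ) / (p : ℚ) ^ j)

theorem tau_single (p k m r : ℕ) (i : ℕ+) (hi : (i : ℕ) = p - 1) :
    tau (-(k : ℤ)) m (Finsupp.single i r) = tauSingle p (m + k) m r := by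
  have hip : (i : ℕ) + 1 = p := by have := i.pos; omega
  have hw : weight (Finsupp.single i r) = r * (p - 1) := by
    simp [weight, hi, mul_comm]
  have hd : parts (Finsupp.single i r) = r := by simp [parts]
  have hl : lam (Finsupp.single i r) = p ^ r := by simp [lam, hip]
  have hm : (Finsupp.single i r).multinomial = 1 := by
    rw [Finsupp.multinomial_eq]
    rcases eq_or_ne r 0 with rfl | hr
    · simp
    · rw [Finsupp.support_single _ hr, Nat.multinomial_singleton]
  have hc : Ring.choose (-(k : ℤ) - m - 1) r = (-1) ^ r * ((m + k + r).choose r : ℤ) := by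
    rw [show -(k : ℤ) - m - 1 = -((m + k + 1 : ℕ) : ℤ) by push_cast; ring, Ring.choose_neg,
      show ((m + k + 1 : ℕ) : ℤ) + r - 1 = ((m + k + r : ℕ) : ℤ) by push_cast; ring,
      Ring.choose_natCast, Int.negOnePow_def, Units.smul_def]
    simp
  rw [tau, tU, hw, hd, hl, hm, hc, tauSingle]
  push_cast
  ring

theorem tauSingle_ne_zero {p : ℕ} (hp : p ≠ 0) (n : ℕ) {m j : ℕ} (h : j * (p - 1) ≤ m) :
    tauSingle p n m j ≠ 0 := by
  have h1 : m.descFactorial (j * (p - 1)) ≠ 0 := by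
    rw [Ne, Nat.descFactorial_eq_zero_iff_lt]; omega
  have h2 : (n + j).choose j ≠ 0 := (Nat.choose_pos (by omega)).ne'
  have : (p : ℚ) ≠ 0 := by exact_mod_cast hp
  unfold tauSingle
  positivity

/-- The falling factorial `(m)_w` splits after `j(p-1)` factors. The first block completes `τ_j`,
the second supplies the factorial that Hurwitz integrality needs. -/
theorem descFactorial_mul_coeff_eq_sum {p : ℕ} {n m w : ℕ} {F : PowerSeries ℚ}
    {E : ℕ → PowerSeries ℚ} (hwm : w ≤ m)
    (h : coeff w F = ∑ j ∈ range (w + 1), (-1) ^ j * ((n + j).choose j : ℚ) / (p : ℚ) ^ j *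
      if j * (p - 1) ≤ w then coeff (w - j * (p - 1)) (E j) else 0) :
    (m.factorial : ℚ) / (m - w).factorial * coeff w F =
      ∑ j ∈ range (w + 1), tauSingle p n m j * if j * (p - 1) ≤ w then
        ((m - j * (p - 1)).choose (w - j * (p - 1)) : ℚ) *
          ((w - j * (p - 1)).factorial * coeff (w - j * (p - 1)) (E j)) else 0 := by
  rw [h, mul_sum]
  refine sum_congr rfl fun j _ => ?_
  split_ifs with hj
  · have h1 : (m.factorial : ℚ) / (m - w).factorial = m.descFactorial w := by
      rw [div_eq_iff (by positivity), ← Nat.factorial_mul_descFactorial hwm]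
      push_cast
      ring
    have h2 : m.descFactorial w = m.descFactorial (j * (p - 1)) *
        ((w - j * (p - 1)).factorial * (m - j * (p - 1)).choose (w - j * (p - 1))) := by
      rw [← Nat.descFactorial_eq_factorial_mul_choose, mul_comm,
        Nat.descFactorial_mul_descFactorial hj]
    rw [h1, h2, tauSingle]
    push_cast
    ring
  · simp

section padic

/-! ### Reduction modulo `p` to the single number `τ_r`. -/

variable {p : ℕ} [Fact p.Prime]

/-- In degree `w = j(p-1)` the number `τ_j` occurs with coefficient 1 and otherwise only `τ_{j'}`
with `j' < j`, so the system can be solved integrally. -/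
theorem padicNorm_mul_tauSingle_le_one (hodd : p ≠ 2) (n m : ℕ) (P : ℚ)
    (hc : ∀ i ≤ m, padicNorm p (P * ((m.factorial : ℚ) / i.factorial *
      coeff (m - i) (logQuot⁻¹ ^ (n + 1) * (1 + X)⁻¹))) ≤ 1) (j : ℕ) (hj : j * (p - 1) ≤ m) :
    padicNorm p (P * tauSingle p n m j) ≤ 1 := by
  have hp : p.Prime := Fact.out
  have hp1 : 0 < p - 1 := by have := hp.two_le; omega
  obtain ⟨E, hE, hE1, hsum⟩ := exists_coeff_logQuot_inv_pow_mul (p := p) hodd n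
    (H := (1 + X)⁻¹) integralSeries_one_add_X_inv (by simp)
  induction j using Nat.strong_induction_on with
  | _ j ih =>
    set w := j * (p - 1) with hw
    have key := descFactorial_mul_coeff_eq_sum hj (hsum w)
    have hmem : j ∈ range (w + 1) := by
      rw [mem_range, hw]
      have := Nat.le_mul_of_pos_right j hp1
      omega
    rw [← add_sum_erase _ _ hmem] at key
    rw [if_pos hw.ge, ← hw, Nat.sub_self, Nat.choose_zero_right, Nat.factorial_zero,
      coeff_zero_eq_constantCoeff_apply, hE1] at key
    have h1 := hc (m - w) (by omega)
    rw [Nat.sub_sub_self hj, key] at h1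
    have h2 : padicNorm p (P * ∑ j' ∈ (range (w + 1)).erase j, tauSingle p n m j' *
        if j' * (p - 1) ≤ w then ((m - j' * (p - 1)).choose (w - j' * (p - 1)) : ℚ) *
          ((w - j' * (p - 1)).factorial * coeff (w - j' * (p - 1)) (E j')) else 0) ≤ 1 := by
      rw [mul_sum]
      refine padicNorm.sum_le' (fun j' hj' => ?_) zero_le_one
      split_ifs with hle
      · have hlt : j' < j := by
          have := Nat.le_of_mul_le_mul_right (hw ▸ hle) hp1
          have := (mem_erase.1 hj').1
          omega
        rw [← mul_assoc]
        exact padicNorm_mul_le_one (ih j' hlt (hle.trans hj)) (padicNorm_mul_le_one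
          (padicNorm.of_nat _) ((hE j').hurwitzIntegral _))
      · simp
    rw [mul_add] at h1
    have h3 := padicNorm_add_le_one h1 (by rwa [← padicNorm.neg] at h2)
    rw [add_neg_cancel_right] at h3
    simpa using h3

/-- The term of index `j` involves `E_j` in degree `(r - j)(p - 1)`. This is at least `p` unless `j
≥ r - 1`, so only `j = r - 1` needs a separate hypothesis. -/
theorem padicNorm_mul_coeff_sub_tauSingle_lt_one (hodd : p ≠ 2) (n r : ℕ) (P : ℚ)
    (hT : ∀ j ≤ r, padicNorm p (P * tauSingle p n (r * (p - 1)) j) ≤ 1)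
    (hT1 : ∀ j, j + 1 = r → padicNorm p (P * tauSingle p n (r * (p - 1)) j) < 1)
    {H : PowerSeries ℚ} (hH : IntegralSeries p H) (hH1 : constantCoeff H = 1) :
    padicNorm p (P * ((r * (p - 1)).factorial *
      coeff (r * (p - 1)) (logQuot⁻¹ ^ (n + 1) * H)) -
        P * tauSingle p n (r * (p - 1)) r) < 1 := by
  have hp : p.Prime := Fact.out
  have h3 : 3 ≤ p := by have := hp.two_le; omega
  have hp1 : 0 < p - 1 := by omega
  obtain ⟨E, hE, hE1, hsum⟩ := exists_coeff_logQuot_inv_pow_mul (p := p) hodd n hH hH1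
  set w := r * (p - 1) with hw
  have key := descFactorial_mul_coeff_eq_sum (m := w) le_rfl (hsum w)
  have hmem : r ∈ range (w + 1) := by
    rw [mem_range, hw]
    have := Nat.le_mul_of_pos_right r hp1
    omega
  rw [← add_sum_erase _ _ hmem, if_pos hw.ge, ← hw, Nat.sub_self, Nat.choose_zero_right,
    Nat.factorial_zero, coeff_zero_eq_constantCoeff_apply, hE1, Nat.cast_one, div_one, mul_one,
    mul_one, mul_one] at key
  rw [key, mul_add, add_sub_cancel_left, mul_sum]
  refine padicNorm.sum_lt' (fun j hj => ?_) one_pos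
  split_ifs with hle
  · have hlt : j < r := by
      have := Nat.le_of_mul_le_mul_right (hw ▸ hle) hp1
      have := (mem_erase.1 hj).1
      omega
    rw [← mul_assoc]
    by_cases hjr : j + 1 = r
    · rw [mul_comm]
      exact padicNorm_mul_lt_one (padicNorm_mul_le_one (padicNorm.of_nat _)
        ((hE j).hurwitzIntegral _)) (hT1 j hjr)
    · refine padicNorm_mul_lt_one (hT j hlt.le) (padicNorm_mul_lt_one (padicNorm.of_nat _)
        ((hE j).factorial_mul_coeff_lt_one ?_))
      have h2 : (j + 2) * (p - 1) ≤ w := Nat.mul_le_mul_right _ (by omega)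
      have : (j + 2) * (p - 1) = j * (p - 1) + 2 * (p - 1) := by ring
      omega
  · simp

/-- The ratio of the last two `τ_j`; the factor `(p-1)!` is a unit at `p`. -/
theorem tauSingle_succ (n r : ℕ) :
    ((r + 1 : ℕ) : ℚ) * p * tauSingle p n ((r + 1) * (p - 1)) (r + 1) =
      -((p - 1).factorial * (n + (r + 1) : ℕ) * tauSingle p n ((r + 1) * (p - 1)) r) := by
  have hp : p.Prime := Fact.out
  have hp0 : (p : ℚ) ≠ 0 := by exact_mod_cast hp.ne_zero
  have h1 : (p - 1).factorial * ((r + 1) * (p - 1)).descFactorial (r * (p - 1)) =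
      ((r + 1) * (p - 1)).descFactorial ((r + 1) * (p - 1)) := by
    rw [Nat.descFactorial_self, ← Nat.factorial_mul_descFactorial
      (show r * (p - 1) ≤ (r + 1) * (p - 1) from Nat.mul_le_mul_right _ (by omega))]
    congr 2
    rw [← Nat.sub_mul]
    simp
  have h2 : (n + (r + 1)) * (n + r).choose r = (n + (r + 1)).choose (r + 1) * (r + 1) := by
    have := Nat.add_one_mul_choose_eq (n + r) r
    rw [← add_assoc, ← this]
  unfold tauSingle
  rw [← h1]
  have h2' : ((n + (r + 1) : ℕ) : ℚ) * ((n + r).choose r : ℚ) =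
      ((n + (r + 1)).choose (r + 1) : ℚ) * ((r + 1 : ℕ) : ℚ) := by exact_mod_cast h2
  rw [Nat.cast_mul ((p - 1).factorial), pow_succ, pow_succ, div_mul_eq_div_div,
    div_eq_mul_inv _ (p : ℚ)]
  have hpI := mul_inv_cancel₀ hp0
  set c : ℚ := (p - 1).factorial * ((r + 1) * (p - 1)).descFactorial (r * (p - 1)) *
    ((-1) ^ r / (p : ℚ) ^ r) with hc
  linear_combination c * h2' -
    c * ((n + (r + 1)).choose (r + 1) : ℚ) * ((r + 1 : ℕ) : ℚ) * hpI

theorem padicNorm_natCast_le_of_emultiplicity_le {a b : ℕ}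
    (h : emultiplicity p a ≤ emultiplicity p b) : padicNorm p b ≤ padicNorm p a := by
  have hp : p.Prime := Fact.out
  rcases eq_or_ne b 0 with rfl | hb
  · simp [padicNorm.nonneg]
  have ha : a ≠ 0 := by
    rintro rfl
    rw [emultiplicity_zero, top_le_iff, emultiplicity_eq_top] at h
    exact h (Nat.finiteMultiplicity_iff.2 ⟨hp.ne_one, Nat.pos_of_ne_zero hb⟩)
  rw [padicNorm.eq_zpow_of_nonzero (by exact_mod_cast hb),
    padicNorm.eq_zpow_of_nonzero (by exact_mod_cast ha), padicValRat.of_nat, padicValRat.of_nat]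
  rw [← padicValNat_eq_emultiplicity ha, ← padicValNat_eq_emultiplicity hb] at h
  have h' : padicValNat p a ≤ padicValNat p b := by exact_mod_cast h
  exact zpow_le_zpow_right₀ (by exact_mod_cast hp.one_le) (by omega)

/-- With `n = r(p-1) + k`, the hypothesis gives `ν(r) = ν(n - k) ≥ ν(k)`. So `k` dominates in `n + r
= rp + k`. -/
theorem padicNorm_mul_lt_padicNorm_add {k r : ℕ} (hr : r ≠ 0)
    (h : emultiplicity p k ≤ emultiplicity p (r * (p - 1) + k)) :
    padicNorm p ((r : ℚ) * p) < padicNorm p ((r * (p - 1) + k + r : ℕ) : ℚ) := by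
  have hp : p.Prime := Fact.out
  have hk := padicNorm_natCast_le_of_emultiplicity_le h
  have h1 : padicNorm p ((p - 1 : ℕ) : ℚ) = 1 := by
    rw [padicNorm.nat_eq_one_iff]
    have := hp.two_le
    exact fun hd => by have := Nat.le_of_dvd (by omega) hd; omega
  have hrk : padicNorm p (r : ℚ) ≤ padicNorm p (k : ℚ) := by
    have e : (r : ℚ) * ((p - 1 : ℕ) : ℚ) = ((r * (p - 1) + k : ℕ) : ℚ) - (k : ℚ) := by
      push_cast; ring
    rw [← mul_one (padicNorm p (r : ℚ)), ← h1, ← padicNorm.mul, e]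
    exact padicNorm.sub.trans (max_le hk le_rfl)
  have hr0 : 0 < padicNorm p (r : ℚ) :=
    lt_of_le_of_ne (padicNorm.nonneg _) (padicNorm.nonzero (by exact_mod_cast hr)).symm
  have hlt : padicNorm p ((r : ℚ) * p) < padicNorm p (k : ℚ) := by
    rw [padicNorm.mul]
    exact (mul_lt_of_lt_one_right hr0 padicNorm.padicNorm_p_lt_one_of_prime).trans_le hrk
  have e : ((r * (p - 1) + k + r : ℕ) : ℚ) = (r : ℚ) * p + k := by
    rw [show r * (p - 1) + k + r = r * (p - 1 + 1) + k by ring,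
      Nat.sub_add_cancel hp.one_le]
    push_cast; ring
  rwa [e, padicNorm.add_eq_max_of_ne hlt.ne, max_eq_right hlt.le]

theorem padicNorm_mul_tauSingle_lt_one {k r : ℕ} (P : ℚ)
    (h : emultiplicity p k ≤ emultiplicity p ((r + 1) * (p - 1) + k))
    (hT : padicNorm p (P * tauSingle p ((r + 1) * (p - 1) + k) ((r + 1) * (p - 1)) (r + 1)) ≤ 1) :
    padicNorm p (P * tauSingle p ((r + 1) * (p - 1) + k) ((r + 1) * (p - 1)) r) < 1 := by
  have hp : p.Prime := Fact.out
  have hlt := padicNorm_mul_lt_padicNorm_add (Nat.succ_ne_zero r) h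
  have e := congrArg (fun x => padicNorm p (P * x))
    (tauSingle_succ (p := p) ((r + 1) * (p - 1) + k) r)
  have hf : padicNorm p ((p - 1).factorial : ℚ) = 1 := by
    rw [padicNorm.nat_eq_one_iff, hp.dvd_factorial]
    have := hp.two_le
    omega
  simp only [mul_neg, padicNorm.neg] at e
  set T := tauSingle p ((r + 1) * (p - 1) + k) ((r + 1) * (p - 1)) r
  set T' := tauSingle p ((r + 1) * (p - 1) + k) ((r + 1) * (p - 1)) (r + 1)
  set N : ℚ := (((r + 1) * (p - 1) + k + (r + 1) : ℕ) : ℚ)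
  rw [mul_left_comm P, padicNorm.mul _ (P * T'), mul_assoc, mul_left_comm P,
    padicNorm.mul ((p - 1).factorial : ℚ), hf,
    one_mul, mul_left_comm P, padicNorm.mul N] at e
  have hN : 0 < padicNorm p N := (padicNorm.nonneg _).trans_lt hlt
  have h1 : padicNorm p N * padicNorm p (P * T) < padicNorm p N * 1 := by
    rw [← e, mul_one]
    exact (mul_le_of_le_one_right (padicNorm.nonneg _) hT).trans_lt hlt
  exact lt_of_mul_lt_mul_left h1 hN.le

/-! ### Poles, valuations and digit sums. -/

theorem padicNorm_maxPole_mul_coeff_le_one (f : Polynomial ℚ) (i : ℕ) :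
    padicNorm p ((p : ℚ) ^ maxPole p f * f.coeff i) ≤ 1 := by
  have hp : p.Prime := Fact.out
  have hp0 : (p : ℚ) ≠ 0 := by exact_mod_cast hp.ne_zero
  rcases eq_or_ne (f.coeff i) 0 with h0 | h0
  · simp [h0]
  have hle : padicValNat p (f.coeff i).den ≤ maxPole p f :=
    Finset.le_sup (f := fun i => padicValNat p (f.coeff i).den) (Polynomial.mem_support_iff.2 h0)
  rw [padicNorm.eq_zpow_of_nonzero (mul_ne_zero (pow_ne_zero _ hp0) h0),
    padicValRat.mul (pow_ne_zero _ hp0) h0, padicValRat.pow, padicValRat.self hp.one_lt,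
    padicValRat_def, mul_one]
  refine zpow_le_one_of_nonpos₀ (by exact_mod_cast hp.one_le) ?_
  omega

theorem padicNorm_pow_mul_eq_one_iff {q : ℚ} (hq : q ≠ 0) (M : ℕ) :
    padicNorm p ((p : ℚ) ^ M * q) = 1 ↔ padicValRat p q = -(M : ℤ) := by
  have hp : p.Prime := Fact.out
  have hp0 : (p : ℚ) ≠ 0 := by exact_mod_cast hp.ne_zero
  rw [padicNorm.eq_zpow_of_nonzero (mul_ne_zero (pow_ne_zero _ hp0) hq),
    padicValRat.mul (pow_ne_zero _ hp0) hq, padicValRat.pow, padicValRat.self hp.one_lt,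
    zpow_eq_one_iff_right₀ (by positivity) (by exact_mod_cast hp.ne_one)]
  constructor <;> intro h <;> linarith

/-- Legendre's formula for `(r(p-1))!` produces the term `r(p-1)`, which cancels the denominator
`p^r`. -/
theorem sub_one_mul_padicValRat_tauSingle (n r : ℕ) :
    ((p : ℚ) - 1) * padicValRat p (tauSingle p n (r * (p - 1)) r) =
      ((p : ℚ) - 1) * padicValNat p ((r + n).choose n) - digitSum p (r * (p - 1)) := by
  have hp : p.Prime := Fact.out
  have hp0 : (p : ℚ) ≠ 0 := by exact_mod_cast hp.ne_zero
  have hfac : ((r * (p - 1)).factorial : ℚ) ≠ 0 := by positivity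
  have hc : ((n + r).choose r : ℚ) ≠ 0 := by
    exact_mod_cast (Nat.choose_pos (by omega)).ne'
  have hs : padicValRat p ((-1 : ℚ) ^ r) = 0 := by
    rcases neg_one_pow_eq_or ℚ r with h | h <;> rw [h] <;> simp
  have hv : padicValRat p (tauSingle p n (r * (p - 1)) r) =
      padicValNat p (r * (p - 1)).factorial + padicValNat p ((r + n).choose n) - r := by
    rw [tauSingle, Nat.descFactorial_self, padicValRat.mul hfac (by positivity),
      padicValRat.div (by positivity) (by positivity), padicValRat.mul (by positivity) hc, hs,
      padicValRat.pow, padicValRat.self hp.one_lt, padicValRat.of_nat, padicValRat.of_nat,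
      add_comm r n, Nat.choose_symm_add]
    ring
  have hleg := sub_one_mul_padicValNat_factorial (p := p) (r * (p - 1))
  have hdig := Nat.digit_sum_le p (r * (p - 1))
  have hleg' : ((p : ℚ) - 1) * padicValNat p (r * (p - 1)).factorial =
      (r : ℚ) * ((p : ℚ) - 1) - digitSum p (r * (p - 1)) := by
    have := congrArg (Nat.cast (R := ℚ)) hleg
    rw [Nat.cast_sub hdig, Nat.cast_mul, Nat.cast_mul, Nat.cast_sub hp.one_le] at this
    simpa [digitSum] using this
  rw [hv]
  simp only [Int.cast_sub, Int.cast_add, Int.cast_natCast]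
  linear_combination hleg'

theorem sub_one_mul_padicValNat_choose (m k : ℕ) :
    ((p : ℚ) - 1) * padicValNat p ((m + k).choose k) =
      digitSum p k + digitSum p m - digitSum p (m + k) := by
  have hp : p.Prime := Fact.out
  have h : ∀ n : ℕ, ((p : ℚ) - 1) * padicValNat p n.factorial = n - digitSum p n := by
    intro n
    have := congrArg (Nat.cast (R := ℚ)) (sub_one_mul_padicValNat_factorial (p := p) n)
    rw [Nat.cast_sub (Nat.digit_sum_le p n), Nat.cast_mul, Nat.cast_sub hp.one_le] at this
    simpa [digitSum] using this
  have hv := congrArg (padicValNat p) (Nat.add_choose_mul_factorial_mul_factorial m k)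
  rw [padicValNat.mul (mul_ne_zero (Nat.choose_pos (by omega)).ne' (Nat.factorial_ne_zero _))
    (Nat.factorial_ne_zero _), padicValNat.mul (Nat.choose_pos (by omega)).ne'
    (Nat.factorial_ne_zero _)] at hv
  have hv' := congrArg (Nat.cast (R := ℚ)) hv
  push_cast at hv'
  have h1 := h (m + k)
  push_cast at h1
  linear_combination ((p : ℚ) - 1) * hv' + h1 - h m - h k

theorem stirlingSecond_pos {n k : ℕ} (hk : 1 ≤ k) (hkn : k ≤ n) : 0 < n.stirlingSecond k := by
  induction n generalizing k with
  | zero => omega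
  | succ n ih =>
    obtain ⟨k, rfl⟩ := Nat.exists_eq_add_of_le' hk
    rw [Nat.stirlingSecond_succ_succ]
    rcases Nat.eq_or_lt_of_le hkn with h | h
    · obtain rfl : k = n := by omega
      simp [Nat.stirlingSecond_self]
    · have := ih (k := k + 1) (by omega) (by omega)
      positivity

theorem choose_mul_coeff_mul_inv (m k : ℕ) :
    ((m + k).choose k : ℚ) *
      (m.factorial * coeff m (logQuot⁻¹ ^ (m + k + 1) * (1 + X)⁻¹)) =
        (m + k).stirlingSecond k := by
  rw [coeff_logQuot_inv_pow_mul]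
  have h : ((m + k).choose k * m.factorial * k.factorial : ℕ) = (m + k).factorial := by
    rw [← Nat.add_choose_mul_factorial_mul_factorial m k]
  have hf : ((m + k).factorial : ℚ) ≠ 0 := by positivity
  have h' : ((m + k).choose k * m.factorial * k.factorial : ℚ) = (m + k).factorial := by
    exact_mod_cast h
  field_simp
  linear_combination ((m + k).stirlingSecond k : ℚ) * h'

theorem choose_mul_coeff (m k : ℕ) :
    ((m + k).choose k : ℚ) * (m.factorial * coeff m (logQuot⁻¹ ^ (m + k + 1))) =
      (m + k + 1).stirlingSecond (k + 1) := by
  rw [coeff_logQuot_inv_pow]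
  have h : ((m + k).choose k * m.factorial * k.factorial : ℕ) = (m + k).factorial := by
    rw [← Nat.add_choose_mul_factorial_mul_factorial m k]
  have hf : ((m + k).factorial : ℚ) ≠ 0 := by positivity
  have h' : ((m + k).choose k * m.factorial * k.factorial : ℚ) = (m + k).factorial := by
    exact_mod_cast h
  field_simp
  linear_combination ((m + k + 1).stirlingSecond (k + 1) : ℚ) * h'

theorem padicNorm_pow_mul_eq_one_iff_of_choose_mul_eq {m k S M : ℕ} {b : ℚ} (hS : S ≠ 0)
    (h : ((m + k).choose k : ℚ) * b = S) :
    (padicValNat p S : ℤ) = padicValNat p ((m + k).choose k) - M ↔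
      padicNorm p ((p : ℚ) ^ M * b) = 1 := by
  have hS' : (S : ℚ) ≠ 0 := by exact_mod_cast hS
  rw [← h] at hS'
  rw [padicNorm_pow_mul_eq_one_iff (right_ne_zero_of_mul hS'), ← padicValRat.of_nat (n := S), ← h,
    padicValRat.mul (left_ne_zero_of_mul hS') (right_ne_zero_of_mul hS'), padicValRat.of_nat]
  omega

end padic

end StirlingPole

/-! ### The equivalences and the valuation formula. -/

theorem mainTheorem6 (p : ℕ) (hp : p.Prime) (hodd : p ≠ 2) (n k r : ℕ)
    (hν : emultiplicity p k ≤ emultiplicity p n)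
    (hr : (r : ℚ) = ((n : ℚ) - k) / ((p : ℚ) - 1)) :
    List.TFAE
      [ StirlingPole.IsAMZC p n k,
        StirlingPole.IsSAMZC p (n + 1) (k + 1),
        (padicValNat p ((r + n).choose n) : ℚ) =
          (StirlingPole.digitSum p (n - k) : ℚ) / ((p : ℚ) - 1) -
            StirlingPole.maxPole p (StirlingPole.higherBernoulli (-(k : ℤ)) (n - k)),
        padicValRat p (StirlingPole.tau (-(k : ℤ)) (n - k)
            (Finsupp.single (⟨p - 1, Nat.sub_pos_of_lt hp.one_lt⟩ : ℕ+) r)) =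
          -(StirlingPole.maxPole p (StirlingPole.higherBernoulli (-(k : ℤ)) (n - k)) : ℤ) ] ∧
    (StirlingPole.IsAMZC p n k →
      padicValNat p (Nat.stirlingSecond (n + 1) (k + 1)) =
          padicValNat p (Nat.stirlingSecond n k) ∧
        (padicValNat p (Nat.stirlingSecond n k) : ℚ) =
          ((StirlingPole.digitSum p k : ℚ) - StirlingPole.digitSum p n) / ((p : ℚ) - 1) +
            padicValNat p ((r + n).choose n)) := by

  have : Fact p.Prime := ⟨hp⟩
  have hp1 : (p : ℚ) - 1 ≠ 0 := by
    have : (1 : ℚ) < p := by exact_mod_cast hp.one_lt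
    linarith
  obtain rfl : n = r * (p - 1) + k := by
    rw [eq_div_iff hp1] at hr
    have : (n : ℚ) = ((r * (p - 1) + k : ℕ) : ℚ) := by
      push_cast [Nat.cast_sub hp.one_le]
      linarith
    exact_mod_cast this
  have htau := StirlingPole.tau_single p k (r * (p - 1)) r
    ⟨p - 1, Nat.sub_pos_of_lt hp.one_lt⟩ rfl
  rw [Nat.add_sub_cancel]
  -- The shift by one makes the order `-(k+1) + 1 = -k`, so the binomial coefficient and the pole
  -- are those of the unshifted case.
  have hSAM : StirlingPole.IsSAMZC p (r * (p - 1) + k + 1) (k + 1) ↔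
      (padicValNat p (Nat.stirlingSecond (r * (p - 1) + k + 1) (k + 1)) : ℤ) =
        padicValNat p ((r * (p - 1) + k).choose k) -
          StirlingPole.maxPole p (StirlingPole.higherBernoulli (-(k : ℤ)) (r * (p - 1))) := by
    unfold StirlingPole.IsSAMZC
    rw [show -((k + 1 : ℕ) : ℤ) + 1 = -(k : ℤ) by push_cast; ring]
    simp only [Nat.add_sub_add_right, Nat.add_sub_cancel]
  have hAM : StirlingPole.IsAMZC p (r * (p - 1) + k) k ↔
      (padicValNat p (Nat.stirlingSecond (r * (p - 1) + k) k) : ℤ) =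
        padicValNat p ((r * (p - 1) + k).choose k) -
          StirlingPole.maxPole p (StirlingPole.higherBernoulli (-(k : ℤ)) (r * (p - 1))) := by
    unfold StirlingPole.IsAMZC
    rw [Nat.add_sub_cancel]
  set m := r * (p - 1) with hm
  set M := StirlingPole.maxPole p (StirlingPole.higherBernoulli (-(k : ℤ)) m) with hM
  have hcoef : ∀ i ≤ m, padicNorm p ((p : ℚ) ^ M * ((m.factorial : ℚ) / i.factorial *
      PowerSeries.coeff (m - i) (StirlingPole.logQuot⁻¹ ^ (m + k + 1) *
        (1 + PowerSeries.X)⁻¹))) ≤ 1 := by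
    intro i hi
    rw [← StirlingPole.sum_stirlingSecond_mul_coeff k m i hi, Finset.mul_sum]
    refine padicNorm.sum_le' (fun q _ => ?_) zero_le_one
    rw [mul_left_comm]
    exact StirlingPole.padicNorm_mul_le_one (padicNorm.of_nat _)
      (StirlingPole.padicNorm_maxPole_mul_coeff_le_one _ _)
  have hT : ∀ j ≤ r, padicNorm p ((p : ℚ) ^ M * StirlingPole.tauSingle p (m + k) m j) ≤ 1 :=
    fun j hj => StirlingPole.padicNorm_mul_tauSingle_le_one hodd _ _ _ hcoef j
      (Nat.mul_le_mul_right _ hj)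
  have hT1 : ∀ j, j + 1 = r →
      padicNorm p ((p : ℚ) ^ M * StirlingPole.tauSingle p (m + k) m j) < 1 := by
    rintro j rfl
    exact StirlingPole.padicNorm_mul_tauSingle_lt_one _ hν (hT _ le_rfl)
  -- The choices `H = (1+z)^{-1}` and `H = 1` yield `S(n,k)` and `S(n+1,k+1)`; both quotients are
  -- compared with the same `τ_r`.
  have hone := StirlingPole.IntegralSeries.one (p := p)
  have hX := StirlingPole.integralSeries_one_add_X_inv (p := p)
  have h0 := StirlingPole.padicNorm_eq_one_iff_of_sub_lt_one
    (StirlingPole.padicNorm_mul_coeff_sub_tauSingle_lt_one hodd (m + k) r _ hT hT1 hX (by simp))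
  have h1 := StirlingPole.padicNorm_eq_one_iff_of_sub_lt_one
    (StirlingPole.padicNorm_mul_coeff_sub_tauSingle_lt_one hodd (m + k) r _ hT hT1 hone (by simp))
  rw [mul_one, ← hm] at h1
  rw [← hm] at h0
  have hS : Nat.stirlingSecond (m + k) k ≠ 0 := by
    rcases Nat.eq_zero_or_pos k with rfl | hk
    -- For `k = 0` the hypothesis reads `∞ ≤ ν(n)`, which forces `n = 0` and `S(0,0) = 1`.
    · have hmz : m = 0 := by
        by_contra hne
        rw [emultiplicity_zero, top_le_iff, emultiplicity_eq_top] at hν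
        exact hν (Nat.finiteMultiplicity_iff.2 ⟨hp.ne_one, by omega⟩)
      simp [hmz]
    · exact (StirlingPole.stirlingSecond_pos hk (by omega)).ne'
  have hS1 : Nat.stirlingSecond (m + k + 1) (k + 1) ≠ 0 :=
    (StirlingPole.stirlingSecond_pos (by omega) (by omega)).ne'
  have t14 : StirlingPole.IsAMZC p (m + k) k ↔
      padicValRat p (StirlingPole.tauSingle p (m + k) m r) = -(M : ℤ) := by
    rw [hAM, StirlingPole.padicNorm_pow_mul_eq_one_iff_of_choose_mul_eq hS
      (StirlingPole.choose_mul_coeff_mul_inv m k), h0,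
      StirlingPole.padicNorm_pow_mul_eq_one_iff (StirlingPole.tauSingle_ne_zero hp.ne_zero _ le_rfl)]
  have t24 : StirlingPole.IsSAMZC p (m + k + 1) (k + 1) ↔
      padicValRat p (StirlingPole.tauSingle p (m + k) m r) = -(M : ℤ) := by
    rw [hSAM, StirlingPole.padicNorm_pow_mul_eq_one_iff_of_choose_mul_eq hS1
      (StirlingPole.choose_mul_coeff m k), h1,
      StirlingPole.padicNorm_pow_mul_eq_one_iff (StirlingPole.tauSingle_ne_zero hp.ne_zero _ le_rfl)]
  have hval := StirlingPole.sub_one_mul_padicValRat_tauSingle (p := p) (m + k) r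
  rw [← hm] at hval
  have t34 : (padicValNat p ((r + (m + k)).choose (m + k)) : ℚ) =
        (StirlingPole.digitSum p m : ℚ) / ((p : ℚ) - 1) - M ↔
      padicValRat p (StirlingPole.tauSingle p (m + k) m r) = -(M : ℤ) := by
    rw [← @Int.cast_inj ℚ, ← mul_right_inj' hp1, ← mul_right_inj' (b := Int.cast _) hp1, hval,
      mul_sub, mul_div_cancel₀ _ hp1]
    push_cast
    constructor <;> intro h <;> linarith
  refine ⟨?_, fun h => ?_⟩
  · rw [htau]
    tfae_have 1 ↔ 4 := t14
    tfae_have 2 ↔ 4 := t24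
    tfae_have 3 ↔ 4 := t34
    tfae_finish
  · have e1 := hAM.1 h
    have e2 := hSAM.1 (t24.2 (t14.1 h))
    have e3 := t34.2 (t14.1 h)
    refine ⟨by omega, ?_⟩
    have hch := StirlingPole.sub_one_mul_padicValNat_choose (p := p) m k
    have e1' := congrArg (Int.cast (R := ℚ)) e1
    simp only [Int.cast_sub, Int.cast_natCast] at e1'
    rw [e1', e3]
    field_simp
    linear_combination hch
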